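/- Let $p$ be an odd prime, $n\ge 1$, and let $\mathbf P=\mathbb F_p[x_1,\dots,x_n]$ carry the action of the Steenrod reduced powers $P^r$ ($P^0=1$, $P^1x_i=x_i^p$, $P^rx_i=0$ for $r>1$, and the Cartan formula). Let $\chi$ be the canonical anti-automorphism of the Steenrod algebra (so $\chi(P^0)=1$ and $\sum_{i+j=r}P^i\chi(P^j)=0$ for $r>0$), and put $\widehat P^{\,r}=(-1)^r\chi(P^r)$. Let $\lambda=(\lambda_1\ge\dots\ge\lambda_n>0)$ be a $\mathbf T$-regular partition of length $n$; that is, with $\lambda_{n+1}=0$, $\lambda_i-\lambda_{i+1}\le p-1$ for $1\le i\le n$, and for each $a\ge1$ at most one $i$ satisfies $(a-1)(p-1)<\lambda_i<a(p-1)$. Let $\gamma_j$ be the number of boxes of the diagram of $\lambda$ in columns $(j-1)(p-1)+1,\dots,j(p-1)$, let $m$ be the number of nonzero $\gamma_j$, and write $\gamma_1=(N-1)(p-1)+b$ with $N\ge1$, $1\le b\le p-1$. Put $p_k=(p^k-1)/(p-1)$ and $$r_1=(b+1)p_{N-1}-(N-1)-\sum_{j=2}^m p^{j-2}\gamma_j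 .$$ For $1\le k\le\gamma_1$ the $k$th antidiagonal is the set of boxes $(i,j)$ (row $i$, column $j$) of the diagram with $j+i(p-1)=k+p-1$; let $s_k$ be its length and $n_k$ the row of its lowest box. Let $v_k(\lambda)$ be the determinant of the $s_k\times s_k$ matrix whose $(a,c)$ entry is $x_{n_k-s_k+c}^{\,p^{a-1}}$ ($1\le a,c\le s_k$), and let $v(\lambda)=\prod_{k=1}^{\gamma_1}v_k(\lambda)$. Then $r_1\ge0$, $v(\lambda)\ne0$, and $$\frac{\widehat P^{\,r_1}v(\lambda)}{v(\lambda)}=\prod_{k=1}^{\gamma_1}\ \prod_{\mathbf c}\,(c_1x_1+\dots+c_{n_k-1}x_{n_k-1}+x_{n_k}),$$ where the inner product is over all vectors $\mathbf c=(c_1,\dots,c_{n_k-1})\in\mathbb F_p^{\,n_k-1}$ with $(c_1,\dots,c_{n_k-s_k})\ne(0,\dots,0)$. (In particular $v(\lambda)$ divides $\widehat P^{\,r_1}v(\lambda)$ in $\mathbf P$.) -/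

import Mathlib

open scoped BigOperators

noncomputable section

/-- The total Steenrod power on `𝔽_p[x_i : i ∈ σ]`: the ring homomorphism into polynomials in an
auxiliary variable `t` with `x_i ↦ x_i + x_i ^ p t`. That it is a ring homomorphism is the Cartan
formula. -/
def totalSteenrodPower (p : ℕ) (σ : Type*) :
    MvPolynomial σ (ZMod p) →ₐ[ZMod p] Polynomial (MvPolynomial σ (ZMod p)) :=
  MvPolynomial.aeval fun i =>
    Polynomial.C (MvPolynomial.X i) + Polynomial.C (MvPolynomial.X i ^ p) * Polynomial.X

/-- The action of the Steenrod reduced power `P^r` on the polynomial algebra: the coefficient of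
`t ^ r` in the total power. -/
def steenrodPower (p : ℕ) (σ : Type*) (r : ℕ) :
    Module.End (ZMod p) (MvPolynomial σ (ZMod p)) :=
  ((Polynomial.lcoeff (MvPolynomial σ (ZMod p)) r).restrictScalars (ZMod p)).comp
    (totalSteenrodPower p σ).toLinearMap

/-- The action of `χ(P^r)` on the polynomial algebra, where `χ` is the canonical anti-automorphism
(antipode) of the Steenrod algebra. As `Δ(P^r) = ∑ P^i ⊗ P^(r-i)`, its values on the generators
are given by `χ(P^0) = 1` and `∑_{i + j = r} P^i χ(P^j) = 0` for `r > 0`. -/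
def chiSteenrodPower (p : ℕ) (σ : Type*) : ℕ → Module.End (ZMod p) (MvPolynomial σ (ZMod p))
  | 0 => 1
  | r + 1 => -∑ j : Fin (r + 1), steenrodPower p σ (r + 1 - (j : ℕ)) * chiSteenrodPower p σ (j : ℕ)

/-- The signed conjugate power `(-1)^r χ(P^r)`. -/
def hatSteenrodPower (p : ℕ) (σ : Type*) (r : ℕ) :
    Module.End (ZMod p) (MvPolynomial σ (ZMod p)) :=
  (-1) ^ r * chiSteenrodPower p σ r

/-- Column `p`-regularity, `λ_i - λ_{i+1} ≤ p - 1` for all `i`. (`rowLen` counts rows from `0`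
and is `0` below the last row.) -/
def IsColumnRegular (p : ℕ) (lam : YoungDiagram) : Prop :=
  ∀ i, lam.rowLen i ≤ lam.rowLen (i + 1) + (p - 1)

/-- `T`-regular partitions: column `p`-regular, and for every `a ≥ 1` at most one row `i` satisfies
`(a - 1)(p - 1) < λ_i < a(p - 1)`. -/
def IsTRegular (p : ℕ) (lam : YoungDiagram) : Prop :=
  IsColumnRegular p lam ∧
    ∀ a, 1 ≤ a → ∀ i i',
      (a - 1) * (p - 1) < lam.rowLen i → lam.rowLen i < a * (p - 1) →
      (a - 1) * (p - 1) < lam.rowLen i' → lam.rowLen i' < a * (p - 1) → i = i'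

/-- The part `γ_j` (`j ≥ 1`) of the `T`-conjugate: the number of boxes in the `j`th block of
`p - 1` columns. (Cells of a `YoungDiagram` are `(row, column)` pairs counted from `0`.) -/
def tConjugate (p : ℕ) (lam : YoungDiagram) (j : ℕ) : ℕ :=
  (lam.cells.filter fun c => (j - 1) * (p - 1) ≤ c.2 ∧ c.2 < j * (p - 1)).card

/-- The number `m` of blocks of `p - 1` columns, i.e. the length of the `T`-conjugate. -/
def tLength (p : ℕ) (lam : YoungDiagram) : ℕ := lam.rowLen 0 ⌈/⌉ (p - 1)

/-- `p_k = (p ^ k - 1) / (p - 1)`; the division is exact. -/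
def pNumber (p k : ℕ) : ℕ := (p ^ k - 1) / (p - 1)

/-- `r_1 = (b + 1) p_{N-1} - (N - 1) - ∑_{j=2}^m p^{j-2} γ_j`, where `γ_1 = (N - 1)(p - 1) + b`
with `N ≥ 1` and `1 ≤ b ≤ p - 1`. -/
def firstExponent (p : ℕ) (lam : YoungDiagram) : ℤ :=
  let N : ℕ := (tConjugate p lam 1 - 1) / (p - 1) + 1
  let b : ℕ := (tConjugate p lam 1 - 1) % (p - 1) + 1
  ((b : ℤ) + 1) * (pNumber p (N - 1) : ℤ) - ((N : ℤ) - 1)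
    - ∑ j ∈ Finset.Icc 2 (tLength p lam), (p : ℤ) ^ (j - 2) * (tConjugate p lam j : ℤ)

/-- The `k`th antidiagonal (`k ≥ 1`): the boxes whose row `i` and column `j`, counted from `1`,
satisfy `j + i(p - 1) = k + (p - 1)`. -/
def antidiagonalBoxes (p : ℕ) (lam : YoungDiagram) (k : ℕ) : Finset (ℕ × ℕ) :=
  lam.cells.filter fun c => (c.2 + 1) + (c.1 + 1) * (p - 1) = k + (p - 1)

/-- The length `s_k` of the `k`th antidiagonal. -/
def antidiagonalLength (p : ℕ) (lam : YoungDiagram) (k : ℕ) : ℕ :=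
  (antidiagonalBoxes p lam k).card

/-- The row `n_k`, counted from `1`, of the lowest box of the `k`th antidiagonal. -/
def antidiagonalLowRow (p : ℕ) (lam : YoungDiagram) (k : ℕ) : ℕ :=
  (antidiagonalBoxes p lam k).sup fun c => c.1 + 1

/-- The variable `x_i` of `𝔽_p[x_1, …, x_n]`, for `1 ≤ i ≤ n` (and `0` for other `i`). -/
def polyVar (p n i : ℕ) : MvPolynomial (Fin n) (ZMod p) :=
  if h : 1 ≤ i ∧ i ≤ n then MvPolynomial.X ⟨i - 1, by omega⟩ else 0

/-- `v_k(λ) = [x_{i-s+1}, x_{i-s+2}^p, …, x_i^{p^{s-1}}]` with `i = n_k` and `s = s_k`, the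
determinant whose row `a` and column `b` (counted from `0`) hold `x_{i-s+1+b} ^ (p ^ a)`. -/
def antidiagonalDet (p n : ℕ) (lam : YoungDiagram) (k : ℕ) : MvPolynomial (Fin n) (ZMod p) :=
  Matrix.det (Matrix.of fun a b : Fin (antidiagonalLength p lam k) =>
    polyVar p n (antidiagonalLowRow p lam k - antidiagonalLength p lam k + 1 + b) ^ p ^ (a : ℕ))

/-- `v(λ) = ∏_{k=1}^{γ_1} v_k(λ)`. -/
def vPoly (p n : ℕ) (lam : YoungDiagram) : MvPolynomial (Fin n) (ZMod p) :=
  ∏ k ∈ Finset.Icc 1 (tConjugate p lam 1), antidiagonalDet p n lam k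

/-- The linear form `c_1 x_1 + ⋯ + c_{N-1} x_{N-1} + x_N`. -/
def monicLinearForm (p n N : ℕ) (c : Fin (N - 1) → ZMod p) : MvPolynomial (Fin n) (ZMod p) :=
  ∑ i : Fin (N - 1), MvPolynomial.C (c i) * polyVar p n (i + 1) + polyVar p n N

/-- The vectors `(c_1, …, c_{N-1})` over `𝔽_p` with `(c_1, …, c_{N-s}) ≠ (0, …, 0)`. -/
def factorVectors (p N s : ℕ) : Set (Fin (N - 1) → ZMod p) :=
  {c | ∃ i : Fin (N - 1), (i : ℕ) + 1 ≤ N - s ∧ c i ≠ 0}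

end

/-!
On a variable `x` the signed conjugate powers have the generating function
`S(x) = ∑ₑ x ^ (p ^ e) t ^ (pₑ)`, `pₑ = (p ^ e - 1) / (p - 1)`, characterised by `S = x + t S ^ p`,
and they are multiplicative (`hatSteenrodPower_apply`). So the polynomial sought is the coefficient
of a power of `t` in `v(λ)` with every `x_i` replaced by `S(x_i)`.

Each factor `v_k` is the Moore determinant of the `s = s_k` consecutive variables ending with
`x_{n_k}`. The functional equation and row operations show that `t ^ (p_{s-1}) v_k(S)` is a linear
combination of the series `S(x_i)`, `i ≤ n_k`, whose top coefficient, that of `S(x_{n_k})`, is the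
Moore determinant of the `s - 1` variables before `x_{n_k}`
(`X_pow_mul_mooreDet_conjugateSeries`).

Let `γ = γ_1 = (n - 1)(p - 1) + b` be the number of factors. After these shifts the coefficient to
extract is that of `t ^ R` with `R = ∑_k p_{n_k - 1}`, for which
`(p - 1) R + γ = (b + 1) p ^ (n - 1) - 1` has base `p` digit sum exactly `γ`. If some `S(x_i)` is
chosen `p` times when the product is expanded, then `S(x_i) ^ p` again behaves like a single series
of this kind, fewer than `γ` powers of `p` are left to add up to this number, and the contribution
vanishes. As `n_k` takes each value at most `p - 1` times, and each value below `n` exactly `p - 1`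
times, a pigeonhole argument leaves only the choice of the top term in every factor
(`coeff_prod_sum_conjugateSeries`). Hence the answer is the product of the top coefficients with a
quantity `T`, the coefficient of `t ^ R` in `∏_k S(x_{n_k})`, independent of the lengths `s_k`.

Applied to the Moore determinants of all of `x_1, …, x_{n_k}` the same argument yields `T`, because
there `t ^ R` is the lowest term (`hatSteenrodPower_prod_windowDet`). Finally a Moore determinant is
a product of linear forms (`mooreDet_succ`), and comparing the factors gives the formula
(`windowDet_mul_windowDet`). The rest is counting boxes along antidiagonals of the diagram.
-/

/-! ### Sums of base `p` digits -/

theorem sum_digits_add_le (p a b : ℕ) [Fact p.Prime] :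
    (p.digits (a + b)).sum ≤ (p.digits a).sum + (p.digits b).sum := by
  have ha := sub_one_mul_padicValNat_factorial (p := p) a
  have hb := sub_one_mul_padicValNat_factorial (p := p) b
  have hab := sub_one_mul_padicValNat_factorial (p := p) (a + b)
  have h1 : padicValNat p a.factorial + padicValNat p b.factorial ≤
      padicValNat p (a + b).factorial := by
    rw [← padicValNat.mul a.factorial_ne_zero b.factorial_ne_zero]
    exact padicValNat_dvd_iff_le (a + b).factorial_ne_zero |>.1
      (pow_padicValNat_dvd.trans (Nat.factorial_mul_factorial_dvd_factorial_add a b))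
  have h2 := Nat.mul_le_mul_left (p - 1) h1
  have := Nat.digit_sum_le p a
  have := Nat.digit_sum_le p b
  have := Nat.digit_sum_le p (a + b)
  rw [mul_add] at h2
  omega

theorem sum_digits_pow (p e : ℕ) [hp : Fact p.Prime] : (p.digits (p ^ e)).sum = 1 := by
  have h := Nat.digits_base_pow_mul (k := e) hp.out.one_lt one_pos
  rw [mul_one] at h
  rw [h, Nat.digits_of_lt p 1 one_ne_zero hp.out.one_lt]
  simp

/-- The base `p` digits of `(b + 1) p ^ n - 1` are `n` times `p - 1` and then `b`. -/
theorem sum_digits_mul_pow_sub_one (p b n : ℕ) [hp : Fact p.Prime] (hb : b < p) :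
    (p.digits ((b + 1) * p ^ n - 1)).sum = n * (p - 1) + b := by
  have h1 := hp.out.one_lt
  induction n with
  | zero =>
    rcases Nat.eq_zero_or_pos b with rfl | h
    · simp
    · simp [Nat.digits_of_lt p b h.ne' hb]
  | succ n ih =>
    have hpos : 0 < (b + 1) * p ^ n := by positivity
    have : (b + 1) * p ^ (n + 1) - 1 = (p - 1) + p * ((b + 1) * p ^ n - 1) := by
      rw [Nat.mul_sub, pow_succ]
      have : p ≤ p * ((b + 1) * p ^ n) := Nat.le_mul_of_pos_right _ hpos
      have h : (b + 1) * (p ^ n * p) = p * ((b + 1) * p ^ n) := by ring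
      omega
    rw [this, Nat.digits_add p h1 _ _ (by omega) (by omega), List.sum_cons, ih]
    ring

/-! ### The series of conjugate powers of a generator -/

open Classical in
/-- The power series `∑ₑ x ^ (p ^ e) t ^ (pₑ)` with `pₑ = (p ^ e - 1) / (p - 1)`. The exponents
`N = pₑ` are those for which `(p - 1) N + 1` is a power of `p`, namely `p ^ e`. -/
noncomputable def conjugateSeries (p : ℕ) {A : Type*} [CommRing A] (x : A) : PowerSeries A :=
  PowerSeries.mk fun N =>
    if ∃ e, (p - 1) * N + 1 = p ^ e then x ^ ((p - 1) * N + 1) else 0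

theorem coeff_pow_char {p : ℕ} [hp : Fact p.Prime] {A : Type*} [CommRing A] [CharP A p]
    (f : PowerSeries A) (N : ℕ) :
    PowerSeries.coeff N (f ^ p) = if p ∣ N then PowerSeries.coeff (N / p) f ^ p else 0 := by
  have : ExpChar A p := ExpChar.prime hp.out
  have h : PowerSeries.map (frobenius A p) (PowerSeries.expand p hp.out.ne_zero f) = f ^ p :=
    MvPowerSeries.map_frobenius_expand p hp.out.ne_zero
  rw [← h, PowerSeries.coeff_map, PowerSeries.coeff_expand]
  split_ifs
  · rw [frobenius_def]
  · exact map_zero _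

/-- The functional equation `S = x + t S ^ p`, which says that `x ↦ S` inverts the total power
`x ↦ x + t x ^ p` up to the sign of `t`. -/
theorem conjugateSeries_eq {p : ℕ} [hp : Fact p.Prime] {A : Type*} [CommRing A] [CharP A p]
    (x : A) :
    conjugateSeries p x = PowerSeries.C x + PowerSeries.X * conjugateSeries p x ^ p := by
  have h1 := hp.out.one_lt
  ext N
  rcases N with _ | N
  · have : ∃ e, 1 = p ^ e := ⟨0, by simp⟩
    simp [conjugateSeries, this]
  · rw [map_add, PowerSeries.coeff_succ_X_mul, PowerSeries.coeff_C, if_neg N.succ_ne_zero,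
      zero_add, coeff_pow_char]
    simp only [conjugateSeries, PowerSeries.coeff_mk]
    have hN : (p - 1) * (N + 1) + 1 = (p - 1) * N + p := by
      rw [mul_add]; omega
    by_cases hd : p ∣ N
    · obtain ⟨M, rfl⟩ := hd
      have hM : (p - 1) * (p * M + 1) + 1 = p * ((p - 1) * M + 1) := by rw [hN]; ring
      have hiff : (∃ e, p * ((p - 1) * M + 1) = p ^ e) ↔ ∃ e, (p - 1) * M + 1 = p ^ e := by
        constructor
        · rintro ⟨e, he⟩
          rcases e with _ | e
          · exact absurd (Nat.eq_one_of_mul_eq_one_right (he.trans (pow_zero p))) h1.ne'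
          · exact ⟨e, Nat.eq_of_mul_eq_mul_left hp.out.pos (by rw [he, pow_succ'])⟩
        · rintro ⟨e, he⟩
          exact ⟨e + 1, by rw [he, pow_succ']⟩
      rw [if_pos (dvd_mul_right p M), Nat.mul_div_cancel_left _ hp.out.pos, hM]
      by_cases hE : ∃ e, (p - 1) * M + 1 = p ^ e
      · rw [if_pos hE, if_pos (hiff.2 hE), ← pow_mul, mul_comm]
      · rw [if_neg hE, if_neg fun h => hE (hiff.1 h), zero_pow hp.out.ne_zero]
    · rw [if_neg hd, if_neg]
      rintro ⟨e, he⟩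
      rw [hN] at he
      rcases e with _ | e
      · rw [pow_zero] at he; omega
      · have h2 : p ∣ (p - 1) * N + p := he ▸ dvd_pow_self p e.succ_ne_zero
        have h3 : p ∣ (p - 1) * N := (Nat.dvd_add_left dvd_rfl).1 h2
        rcases hp.out.dvd_mul.1 h3 with h | h
        · exact absurd (Nat.le_of_dvd (by omega) h) (by omega)
        · exact hd h

theorem conjugateSeries_pow_eq {p : ℕ} [hp : Fact p.Prime] {A : Type*} [CommRing A] [CharP A p]
    (x : A) (a : ℕ) :
    conjugateSeries p x ^ p ^ a =
      PowerSeries.C x ^ p ^ a + PowerSeries.X ^ p ^ a * conjugateSeries p x ^ p ^ (a + 1) := by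
  have : CharP (PowerSeries A) p := charP_of_injective_ringHom PowerSeries.C_injective p
  conv_lhs => rw [conjugateSeries_eq]
  rw [add_pow_char_pow, mul_pow, ← pow_mul, ← pow_succ']

/-! ### Bounds on the digits of exponents -/

/-- All exponents `N` occurring in `f` are such that the base `p` digits of `(p - 1) N + d` add up
to at most `s`. If `f` is a product of `d` series in which only exponents `pₑ` occur, then
`(p - 1) N + d` is a sum of `d` powers of `p`, and `s = d` is a valid bound. -/
def DigitBound (p : ℕ) {A : Type*} [CommRing A] (d s : ℕ) (f : PowerSeries A) : Prop :=
  ∀ N, PowerSeries.coeff N f ≠ 0 → (p.digits ((p - 1) * N + d)).sum ≤ s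

theorem DigitBound.one (p : ℕ) (A : Type*) [CommRing A] : DigitBound p 0 0 (1 : PowerSeries A) := by
  intro N hN
  rw [PowerSeries.coeff_one] at hN
  have : N = 0 := by by_contra h; simp [h] at hN
  simp [this]

theorem DigitBound.mul {p : ℕ} [Fact p.Prime] {A : Type*} [CommRing A] {d s d' s' : ℕ}
    {f g : PowerSeries A} (hf : DigitBound p d s f) (hg : DigitBound p d' s' g) :
    DigitBound p (d + d') (s + s') (f * g) := by
  intro N hN
  rw [PowerSeries.coeff_mul] at hN
  obtain ⟨⟨i, j⟩, hij, h⟩ := Finset.exists_ne_zero_of_sum_ne_zero hN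
  rw [Finset.HasAntidiagonal.mem_antidiagonal] at hij
  have h1 := hf i (left_ne_zero_of_mul h)
  have h2 := hg j (right_ne_zero_of_mul h)
  have h3 : (p - 1) * N + (d + d') = ((p - 1) * i + d) + ((p - 1) * j + d') := by
    rw [← hij]; ring
  rw [h3]
  exact (sum_digits_add_le p _ _).trans (add_le_add h1 h2)

theorem DigitBound.prod {p : ℕ} [Fact p.Prime] {A ι : Type*} [CommRing A] {K : Finset ι}
    {f : ι → PowerSeries A} (hf : ∀ k ∈ K, DigitBound p 1 1 (f k)) :
    DigitBound p K.card K.card (∏ k ∈ K, f k) := by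
  classical
  induction K using Finset.induction_on with
  | empty => simpa using DigitBound.one p A
  | insert a K ha ih =>
    rw [Finset.prod_insert ha, Finset.card_insert_of_notMem ha, add_comm]
    exact (hf a (Finset.mem_insert_self a K)).mul
      (ih fun k hk => hf k (Finset.mem_insert_of_mem hk))

theorem digitBound_conjugateSeries {p : ℕ} [Fact p.Prime] {A : Type*} [CommRing A] (x : A) :
    DigitBound p 1 1 (conjugateSeries p x) := by
  intro N hN
  have : ∃ e, (p - 1) * N + 1 = p ^ e := by
    by_contra h; simp [conjugateSeries, h] at hN
  obtain ⟨e, he⟩ := this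
  rw [he, sum_digits_pow]

/-- A `p`th power of `∑ₑ x ^ (p ^ e) t ^ (pₑ)` behaves like a single such series. -/
theorem digitBound_conjugateSeries_pow {p : ℕ} [hp : Fact p.Prime] {A : Type*} [CommRing A]
    [CharP A p] (x : A) : DigitBound p p 1 (conjugateSeries p x ^ p) := by
  intro N hN
  have h1 := hp.out.one_lt
  have h : PowerSeries.coeff (N + 1) (conjugateSeries p x) ≠ 0 := by
    rw [conjugateSeries_eq, map_add, PowerSeries.coeff_succ_X_mul, PowerSeries.coeff_C,
      if_neg N.succ_ne_zero, zero_add]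
    exact hN
  have h2 := digitBound_conjugateSeries x _ h
  have h3 : (p - 1) * (N + 1) + 1 = (p - 1) * N + p := by
    rw [mul_add]; omega
  rwa [h3] at h2

/-! ### Extraction of the coefficient -/

/-- A map that nowhere exceeds `k ↦ k / q` and has no fibre with more than `q` elements equals
it. -/
theorem eq_div_of_le_div {γ q : ℕ} (hq : 0 < q) (e : Fin γ → ℕ) (he : ∀ k, e k ≤ (k : ℕ) / q)
    (hcard : ∀ j, (Finset.univ.filter fun k => e k = j).card ≤ q) (k : Fin γ) :
    e k = (k : ℕ) / q := by
  obtain ⟨k, hk⟩ := k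
  induction k using Nat.strong_induction_on with
  | _ k ih =>
    by_contra hne
    have hlt : e ⟨k, hk⟩ < k / q := lt_of_le_of_ne (he _) hne
    set j := e ⟨k, hk⟩ with hj
    have hjk : j * q + q ≤ k := by
      have h := Nat.mul_le_mul_right q (Nat.succ_le_of_lt hlt)
      have h' := Nat.div_mul_le_self k q
      rw [Nat.succ_mul] at h
      omega
    -- the fibre over `j` contains `jq, …, jq + q - 1`, by induction, and also `k`
    have hle : (Finset.range (q + 1)).card ≤
        (Finset.univ.filter fun k' : Fin γ => e k' = j).card := by
      refine Finset.card_le_card_of_injOn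
        (fun i => if h : i < q then ⟨j * q + i, by omega⟩ else ⟨k, hk⟩) ?_ ?_
      · intro i _
        simp only [Finset.coe_filter, Finset.mem_univ, true_and, Set.mem_ofPred_eq]
        split_ifs with h
        · rw [ih (j * q + i) (by omega)]
          simp only
          rw [mul_comm, Nat.mul_add_div hq, Nat.div_eq_of_lt h, add_zero]
        · rfl
      · intro a ha b hb hab
        simp only [Finset.coe_range, Set.mem_Iio] at ha hb
        dsimp only at hab
        split_ifs at hab <;> simp only [Fin.mk.injEq] at hab <;> omega
    have := hcard j
    rw [Finset.card_range] at hle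
    omega

/-- A product in which the series of one generator occurs `p` times has no term in the exponents
for which `(p - 1) R + γ` has the largest possible digit sum `γ`. -/
theorem coeff_prod_conjugateSeries_eq_zero {p γ R : ℕ} [hp : Fact p.Prime] {A : Type*}
    [CommRing A] [CharP A p] (x : ℕ → A) (e : Fin γ → ℕ) (j : ℕ)
    (hR : (p.digits ((p - 1) * R + γ)).sum = γ)
    (hj : p ≤ (Finset.univ.filter fun k => e k = j).card) :
    PowerSeries.coeff R (∏ k, conjugateSeries p (x (e k))) = 0 := by
  classical
  obtain ⟨K, hK, hKcard⟩ := Finset.exists_subset_card_eq hj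
  have hprod : ∏ k, conjugateSeries p (x (e k)) =
      (∏ k ∈ Kᶜ, conjugateSeries p (x (e k))) * conjugateSeries p (x j) ^ p := by
    rw [← Finset.prod_compl_mul_prod K, ← hKcard, ← Finset.prod_const]
    congr 1
    exact Finset.prod_congr rfl fun k hk => by rw [(Finset.mem_filter.1 (hK hk)).2]
  have hb := (DigitBound.prod (K := Kᶜ) fun k _ => digitBound_conjugateSeries (x (e k))).mul
    (digitBound_conjugateSeries_pow (x j))
  rw [← hprod] at hb
  by_contra h
  have h1 := hb R h
  have h2 : K.card ≤ Fintype.card (Fin γ) := Finset.card_le_univ K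
  rw [Finset.card_compl, hKcard, Fintype.card_fin] at h1
  rw [hKcard, Fintype.card_fin] at h2
  rw [Nat.sub_add_cancel h2, hR] at h1
  have := hp.out.one_lt
  omega

/-- In the coefficient whose exponent has the largest possible digit sum, only the top term of each
factor survives: every other choice of terms repeats some generator at least `p` times. -/
theorem coeff_prod_sum_conjugateSeries {p γ R : ℕ} [hp : Fact p.Prime] {A : Type*}
    [CommRing A] [CharP A p] (x : ℕ → A) (c : Fin γ → ℕ → A)
    (hR : (p.digits ((p - 1) * R + γ)).sum = γ) :
    PowerSeries.coeff R (∏ k : Fin γ, ∑ j ∈ Finset.range ((k : ℕ) / (p - 1) + 1),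
        PowerSeries.C (c k j) * conjugateSeries p (x j)) =
      (∏ k : Fin γ, c k (k / (p - 1))) *
        PowerSeries.coeff R (∏ k : Fin γ, conjugateSeries p (x (k / (p - 1)))) := by
  have h1 := hp.out.one_lt
  rw [Finset.prod_univ_sum, map_sum]
  simp only [Finset.prod_mul_distrib, ← map_prod, PowerSeries.coeff_C_mul]
  refine Finset.sum_eq_single (fun k : Fin γ => (k : ℕ) / (p - 1)) ?_ ?_
  · intro e he hne
    rw [Fintype.mem_piFinset] at he
    have : ∃ j, p ≤ (Finset.univ.filter fun k => e k = j).card := by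
      by_contra! hcon
      refine hne (funext fun k => eq_div_of_le_div (by omega) e (fun k => ?_) (fun j => ?_) k)
      · exact Nat.lt_succ_iff.1 (Finset.mem_range.1 (he k))
      · have := hcon j
        omega
    obtain ⟨j, hj⟩ := this
    rw [coeff_prod_conjugateSeries_eq_zero x e j hR hj, mul_zero]
  · intro h
    exact absurd (Fintype.mem_piFinset.2 fun k => Finset.self_mem_range_succ _) h

/-! ### The total conjugate power -/

/-- The total signed conjugate power: the ring homomorphism into power series in `t` sending each
variable `x` to `∑ₑ x ^ (p ^ e) t ^ (pₑ)`. -/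
noncomputable def totalConjugatePower (p : ℕ) (σ : Type*) :
    MvPolynomial σ (ZMod p) →ₐ[ZMod p] PowerSeries (MvPolynomial σ (ZMod p)) :=
  MvPolynomial.aeval fun i => conjugateSeries p (MvPolynomial.X i)

theorem coeff_eval₂_neg_X {A B : Type*} [CommRing A] [CommRing B] (φ : A →+* PowerSeries B)
    (g : Polynomial A) (r : ℕ) :
    PowerSeries.coeff r (g.eval₂ φ (-PowerSeries.X)) =
      ∑ ij ∈ Finset.HasAntidiagonal.antidiagonal r,
        (-1) ^ ij.2 * PowerSeries.coeff ij.1 (φ (g.coeff ij.2)) := by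
  induction g using Polynomial.induction_on' with
  | add f g hf hg =>
    simp only [Polynomial.eval₂_add, map_add, hf, hg, Polynomial.coeff_add, mul_add,
      Finset.sum_add_distrib]
  | monomial n a =>
    rw [Polynomial.eval₂_monomial, PowerSeries.coeff_mul]
    refine Finset.sum_congr rfl fun ij _ => ?_
    have h : (-PowerSeries.X : PowerSeries B) ^ n =
        PowerSeries.C ((-1) ^ n) * PowerSeries.X ^ n := by
      rw [neg_pow, map_pow, map_neg, map_one]
    rw [h, PowerSeries.coeff_C_mul, PowerSeries.coeff_X_pow, Polynomial.coeff_monomial]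
    by_cases hn : n = ij.2
    · simp [hn, mul_comm]
    · simp [hn, Ne.symm hn]

/-- The total conjugate power, with the sign of `t` changed, is a left inverse of the total power:
both are multiplicative, and on a variable this is the functional equation of
`conjugateSeries`. -/
theorem eval₂_totalSteenrodPower (p : ℕ) [Fact p.Prime] (σ : Type*)
    (f : MvPolynomial σ (ZMod p)) :
    (totalSteenrodPower p σ f).eval₂ (totalConjugatePower p σ).toRingHom (-PowerSeries.X) =
      PowerSeries.C f := by
  have h : (Polynomial.eval₂RingHom (totalConjugatePower p σ).toRingHom
        (-PowerSeries.X)).comp (totalSteenrodPower p σ).toRingHom =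
      (PowerSeries.C : MvPolynomial σ (ZMod p) →+* _) := by
    refine MvPolynomial.ringHom_ext' (Subsingleton.elim _ _) fun i => ?_
    have h := conjugateSeries_eq (p := p) (MvPolynomial.X i : MvPolynomial σ (ZMod p))
    simp only [RingHom.comp_apply, AlgHom.toRingHom_eq_coe, RingHom.coe_coe, totalSteenrodPower,
      totalConjugatePower, MvPolynomial.aeval_X, Polynomial.coe_eval₂RingHom, Polynomial.eval₂_add,
      Polynomial.eval₂_mul, Polynomial.eval₂_C, Polynomial.eval₂_X, Polynomial.eval₂_pow, map_pow]
    linear_combination h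
  exact RingHom.congr_fun h f

theorem steenrodPower_zero (p : ℕ) (σ : Type*) : steenrodPower p σ 0 = 1 := by
  have h : (Polynomial.constantCoeff).comp (totalSteenrodPower p σ).toRingHom =
      RingHom.id (MvPolynomial σ (ZMod p)) :=
    MvPolynomial.ringHom_ext' (Subsingleton.elim _ _) fun i => by simp [totalSteenrodPower]
  exact LinearMap.ext fun f => RingHom.congr_fun h f

theorem mk_steenrodPower_mul_mk_chiSteenrodPower (p : ℕ) (σ : Type*) :
    PowerSeries.mk (steenrodPower p σ) * PowerSeries.mk (chiSteenrodPower p σ) = 1 := by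
  refine PowerSeries.ext fun r => ?_
  rw [PowerSeries.coeff_mul, PowerSeries.coeff_one]
  simp only [PowerSeries.coeff_mk]
  rcases r with _ | r
  · simp [steenrodPower_zero, chiSteenrodPower]
  · rw [← Finset.Nat.sum_antidiagonal_swap, if_neg r.succ_ne_zero]
    simp only [Prod.fst_swap, Prod.snd_swap]
    rw [Finset.Nat.sum_antidiagonal_eq_sum_range_succ
      (fun i j => steenrodPower p σ j * chiSteenrodPower p σ i), Finset.sum_range_succ,
      Nat.sub_self, steenrodPower_zero, one_mul, chiSteenrodPower,
      Fin.sum_univ_eq_sum_range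
        (fun j => steenrodPower p σ (r + 1 - j) * chiSteenrodPower p σ j)]
    exact add_neg_cancel _

theorem neg_one_pow_end_apply {R M : Type*} [CommRing R] [CommRing M] [Algebra R M] (r : ℕ)
    (f : M) : ((-1 : Module.End R M) ^ r) f = (-1) ^ r * f := by
  induction r with
  | zero => simp
  | succ r ih =>
    rw [pow_succ', pow_succ', Module.End.mul_apply, ih, LinearMap.neg_apply, Module.End.one_apply]
    ring

/-- The antipode is a right inverse of the total power and `totalConjugatePower` a left inverse, so
they agree. -/
theorem hatSteenrodPower_apply (p : ℕ) [Fact p.Prime] (σ : Type*) (r : ℕ)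
    (f : MvPolynomial σ (ZMod p)) :
    hatSteenrodPower p σ r f = PowerSeries.coeff r (totalConjugatePower p σ f) := by
  set S : ℕ → Module.End (ZMod p) (MvPolynomial σ (ZMod p)) := fun r =>
    ((PowerSeries.coeff (R := MvPolynomial σ (ZMod p)) r).restrictScalars (ZMod p)).comp
      (totalConjugatePower p σ).toLinearMap with hS
  have hleft : PowerSeries.mk (fun r => (-1) ^ r * S r) *
      PowerSeries.mk (steenrodPower p σ) = 1 := by
    refine PowerSeries.ext fun r => LinearMap.ext fun f => ?_
    have h := congrArg (PowerSeries.coeff r) (eval₂_totalSteenrodPower p σ f)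
    rw [coeff_eval₂_neg_X, PowerSeries.coeff_C] at h
    rw [PowerSeries.coeff_mul, PowerSeries.coeff_one]
    simp only [PowerSeries.coeff_mk]
    have hsum : (∑ ij ∈ Finset.HasAntidiagonal.antidiagonal r,
        (-1) ^ ij.1 * S ij.1 * steenrodPower p σ ij.2) f =
        (-1) ^ r * ∑ ij ∈ Finset.HasAntidiagonal.antidiagonal r, (-1) ^ ij.2 *
          PowerSeries.coeff ij.1 (totalConjugatePower p σ
            ((totalSteenrodPower p σ f).coeff ij.2)) := by
      rw [LinearMap.sum_apply, Finset.mul_sum]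
      refine Finset.sum_congr rfl fun ij hij => ?_
      rw [Finset.HasAntidiagonal.mem_antidiagonal] at hij
      rw [Module.End.mul_apply, Module.End.mul_apply, neg_one_pow_end_apply, ← hij, ← mul_assoc,
        pow_add, mul_assoc ((-1) ^ ij.1), ← pow_add, Even.neg_one_pow ⟨_, rfl⟩, mul_one]
      rfl
    rw [hsum]
    refine (congrArg ((-1) ^ r * ·) h).trans ?_
    rcases r with _ | r <;> simp
  have h : PowerSeries.mk (fun r => (-1) ^ r * S r) = PowerSeries.mk (chiSteenrodPower p σ) :=
    left_inv_eq_right_inv hleft (mk_steenrodPower_mul_mk_chiSteenrodPower p σ)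
  have hr := congrArg (PowerSeries.coeff r) h
  simp only [PowerSeries.coeff_mk] at hr
  rw [hatSteenrodPower, ← hr, ← mul_assoc, ← pow_add, Module.End.mul_apply,
    neg_one_pow_end_apply, Even.neg_one_pow ⟨_, rfl⟩, one_mul]
  rfl

/-! ### Moore determinants -/

/-- The Moore determinant `det (y_b ^ (p ^ a))`. -/
noncomputable def mooreDet (p : ℕ) {A : Type*} [CommRing A] {s : ℕ} (y : Fin s → A) : A :=
  Matrix.det (Matrix.of fun a b : Fin s => y b ^ p ^ (a : ℕ))

/-- The cofactors of the entries of the last row of a Moore matrix. -/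
noncomputable def mooreCofactor (p : ℕ) {A : Type*} [CommRing A] {s : ℕ} (y : Fin (s + 1) → A)
    (j : Fin (s + 1)) : A :=
  (-1) ^ (s + j : ℕ) * mooreDet p (y ∘ j.succAbove)

theorem mooreCofactor_last (p : ℕ) {A : Type*} [CommRing A] {s : ℕ} (y : Fin (s + 1) → A) :
    mooreCofactor p y (Fin.last s) = mooreDet p (y ∘ Fin.castSucc) := by
  rw [mooreCofactor, Fin.succAbove_last, Fin.val_last, ← two_mul, pow_mul]
  simp

theorem det_replace_last_row (p : ℕ) {A : Type*} [CommRing A] {s : ℕ} (y z : Fin (s + 1) → A) :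
    Matrix.det (Matrix.of fun a b : Fin (s + 1) =>
      if (a : ℕ) < s then y b ^ p ^ (a : ℕ) else z b) = ∑ j, mooreCofactor p y j * z j := by
  rw [Matrix.det_succ_row _ (Fin.last s)]
  refine Finset.sum_congr rfl fun j _ => ?_
  have : (Matrix.of fun a b : Fin (s + 1) =>
      if (a : ℕ) < s then y b ^ p ^ (a : ℕ) else z b).submatrix (Fin.last s).succAbove
        j.succAbove = Matrix.of fun a b : Fin s => (y ∘ j.succAbove) b ^ p ^ (a : ℕ) := by
    ext a b
    simp [Fin.succAbove_last]
  rw [this, mooreCofactor, mooreDet]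
  simp only [Fin.val_last, Matrix.of_apply, lt_irrefl, if_false]
  ring

theorem sum_mooreCofactor_mul_pow (p : ℕ) {A : Type*} [CommRing A] {s : ℕ} (y : Fin (s + 1) → A)
    {e : ℕ} (he : e < s) : ∑ j, mooreCofactor p y j * y j ^ p ^ e = 0 := by
  rw [← det_replace_last_row]
  refine Matrix.det_zero_of_row_eq (i := ⟨e, by omega⟩) (j := Fin.last s) ?_ ?_
  · simp [Fin.ext_iff, he.ne]
  · ext b
    simp [he]

theorem mooreCofactor_map (p : ℕ) {A B : Type*} [CommRing A] [CommRing B] (φ : A →+* B) {s : ℕ}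
    (y : Fin (s + 1) → A) (j : Fin (s + 1)) :
    mooreCofactor p (fun i => φ (y i)) j = φ (mooreCofactor p y j) := by
  simp only [mooreCofactor, mooreDet, map_mul, map_pow, map_neg, map_one, RingHom.map_det]
  congr 2
  ext a b
  simp

theorem pNumber_eq_sum (p k : ℕ) [hp : Fact p.Prime] :
    pNumber p k = ∑ i ∈ Finset.range k, p ^ i := by
  rw [pNumber, Nat.geomSum_eq hp.out.two_le]

theorem pNumber_succ (p k : ℕ) [hp : Fact p.Prime] : pNumber p (k + 1) = pNumber p k + p ^ k := by
  rw [pNumber_eq_sum, pNumber_eq_sum, Finset.sum_range_succ]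

theorem X_pow_pNumber_mul_conjugateSeries {p : ℕ} [hp : Fact p.Prime] {A : Type*} [CommRing A]
    [CharP A p] (x : A) (s : ℕ) :
    PowerSeries.X ^ pNumber p s * conjugateSeries p x ^ p ^ s =
      conjugateSeries p x -
        ∑ e ∈ Finset.range s, PowerSeries.X ^ pNumber p e * PowerSeries.C x ^ p ^ e := by
  induction s with
  | zero => simp [pNumber]
  | succ s ih =>
    have h := conjugateSeries_pow_eq (p := p) x s
    rw [Finset.sum_range_succ, pNumber_succ, pow_add]
    linear_combination ih - PowerSeries.X ^ pNumber p s * h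

/-- The functional equation `S = x + t S ^ p` lets one replace, row after row, `S ^ (p ^ a)` by
`x ^ (p ^ a)` in a Moore matrix, except in the last row. -/
theorem mooreDet_conjugateSeries {p : ℕ} [hp : Fact p.Prime] {A : Type*} [CommRing A]
    [CharP A p] {s : ℕ} (y : Fin (s + 1) → A) :
    mooreDet p (fun j => conjugateSeries p (y j)) =
      ∑ j, PowerSeries.C (mooreCofactor p y j) * conjugateSeries p (y j) ^ p ^ s := by
  simp only [← mooreCofactor_map]
  rw [← det_replace_last_row, mooreDet, ← Matrix.det_submatrix_equiv_self Fin.revPerm,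
    ← Matrix.det_submatrix_equiv_self Fin.revPerm (Matrix.of _)]
  refine Matrix.det_eq_of_forall_row_eq_smul_add_pred
    (fun i => PowerSeries.X ^ p ^ (s - 1 - i : ℕ)) (fun j => ?_) (fun i j => ?_)
  · simp
  · have h1 : s - (i + 1 : ℕ) < s := by omega
    have h2 : s - (i + 1 : ℕ) = s - 1 - i := by omega
    have h3 : s - 1 - (i : ℕ) + 1 = s - i := by omega
    have h := conjugateSeries_pow_eq (p := p) (y j.rev) (s - 1 - i : ℕ)
    rw [h3] at h
    simp only [Matrix.submatrix_apply, Fin.revPerm_apply, Matrix.of_apply, Fin.val_rev,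
      Fin.val_succ, Fin.val_castSucc]
    have h4 : s + 1 - (i + 1 + 1 : ℕ) = s - 1 - i := by omega
    have h5 : s + 1 - (i + 1 : ℕ) = s - i := by omega
    rw [h4, h5, if_pos (by omega), h]

/-- The total conjugate power of a Moore determinant, shifted by a power of `t`, is a combination
of the series of its variables alone. The coefficient of the last one is the Moore determinant of
the remaining variables, by `mooreCofactor_last`. -/
theorem X_pow_mul_mooreDet_conjugateSeries {p : ℕ} [hp : Fact p.Prime] {A : Type*} [CommRing A]
    [CharP A p] {s : ℕ} (y : Fin (s + 1) → A) :
    PowerSeries.X ^ pNumber p s * mooreDet p (fun j => conjugateSeries p (y j)) =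
      ∑ j, PowerSeries.C (mooreCofactor p y j) * conjugateSeries p (y j) := by
  rw [mooreDet_conjugateSeries, Finset.mul_sum]
  have h : ∀ j, PowerSeries.X ^ pNumber p s *
      (PowerSeries.C (mooreCofactor p y j) * conjugateSeries p (y j) ^ p ^ s) =
      PowerSeries.C (mooreCofactor p y j) * conjugateSeries p (y j) -
        ∑ e ∈ Finset.range s, PowerSeries.X ^ pNumber p e *
          PowerSeries.C (mooreCofactor p y j * y j ^ p ^ e) := by
    intro j
    rw [mul_left_comm, X_pow_pNumber_mul_conjugateSeries, mul_sub, Finset.mul_sum]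
    congr 1
    refine Finset.sum_congr rfl fun e _ => ?_
    rw [map_mul, map_pow]
    ring
  rw [Finset.sum_congr rfl fun j _ => h j, Finset.sum_sub_distrib, Finset.sum_comm, sub_eq_self]
  refine Finset.sum_eq_zero fun e he => ?_
  rw [← Finset.mul_sum, ← map_sum, sum_mooreCofactor_mul_pow p y (Finset.mem_range.1 he), map_zero,
    mul_zero]

/-- The Moore determinant with one more variable `z`: it vanishes when `z` is one of the
`p ^ s` combinations of `y_1, …, y_s`, and comparing leading coefficients as polynomials in `z`
factors it into linear forms. -/
theorem mooreDet_succ {p : ℕ} [hp : Fact p.Prime] {A : Type*} [CommRing A] [IsDomain A]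
    [Algebra (ZMod p) A] {s : ℕ} (y : Fin (s + 1) → A)
    (hy : Function.Injective fun c : Fin s → ZMod p =>
      ∑ i, algebraMap (ZMod p) A (c i) * y i.castSucc) :
    mooreDet p y = mooreDet p (y ∘ Fin.castSucc) *
      ∏ c : Fin s → ZMod p, (∑ i, algebraMap (ZMod p) A (c i) * y i.castSucc + y (Fin.last s)) := by
  classical
  have : CharP A p := charP_of_injective_algebraMap (algebraMap (ZMod p) A).injective p
  set l : (Fin s → ZMod p) → A := fun c => ∑ i, algebraMap (ZMod p) A (c i) * y i.castSucc with hl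
  set co : Fin (s + 1) → A := fun i => (-1) ^ (i + s : ℕ) *
    Matrix.det (Matrix.of fun a b : Fin s => y b.castSucc ^ p ^ (i.succAbove a : ℕ)) with hco
  have hco_last : co (Fin.last s) = mooreDet p (y ∘ Fin.castSucc) := by
    simp only [hco, Fin.val_last, ← two_mul, pow_mul, Fin.succAbove_last]
    simp [mooreDet]
  -- the expansion along the last column
  have hexp : ∀ z : A, mooreDet p (Fin.snoc (fun i : Fin s => y i.castSucc) z) =
      ∑ i, co i * z ^ p ^ (i : ℕ) := by
    intro z
    rw [mooreDet, Matrix.det_succ_column _ (Fin.last s)]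
    refine Finset.sum_congr rfl fun i _ => ?_
    have h : (Matrix.of fun a b : Fin (s + 1) =>
        (Fin.snoc (fun i : Fin s => y i.castSucc) z : Fin (s + 1) → A) b ^ p ^ (a : ℕ)).submatrix
          i.succAbove (Fin.last s).succAbove =
        Matrix.of fun a b : Fin s => y b.castSucc ^ p ^ (i.succAbove a : ℕ) := by
      ext a b
      simp [Fin.succAbove_last]
    rw [h, hco]
    simp only [Fin.val_last, Matrix.of_apply, Fin.snoc_last]
    ring
  have hroot : ∀ c, ∑ i, co i * (-l c) ^ p ^ (i : ℕ) = 0 := by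
    intro c
    have hpow : ∀ e : ℕ, (-l c) ^ p ^ e =
        ∑ j, -algebraMap (ZMod p) A (c j) * y j.castSucc ^ p ^ e := by
      intro e
      have h : -l c = ∑ j, algebraMap (ZMod p) A (-c j) * y j.castSucc := by
        simp [hl]
      rw [h, sum_pow_char_pow]
      refine Finset.sum_congr rfl fun j _ => ?_
      rw [mul_pow, ← map_pow, ZMod.pow_card_pow, map_neg]
    simp only [hpow, Finset.mul_sum]
    rw [Finset.sum_comm]
    refine Finset.sum_eq_zero fun j _ => ?_
    have h : ∑ i, co i * y j.castSucc ^ p ^ (i : ℕ) = 0 := by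
      rw [← hexp]
      refine Matrix.det_zero_of_column_eq (i := j.castSucc) (j := Fin.last s)
        (Fin.castSucc_lt_last j).ne fun a => ?_
      simp
    calc ∑ i, co i * (-algebraMap (ZMod p) A (c j) * y j.castSucc ^ p ^ (i : ℕ))
        = -algebraMap (ZMod p) A (c j) * ∑ i, co i * y j.castSucc ^ p ^ (i : ℕ) := by
          rw [Finset.mul_sum]
          exact Finset.sum_congr rfl fun i _ => by ring
      _ = 0 := by rw [h, mul_zero]
  set G : Polynomial A := ∏ c : Fin s → ZMod p, (Polynomial.X + Polynomial.C (l c)) with hG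
  have hGm : G.Monic := Polynomial.monic_prod_of_monic _ _ fun c _ => Polynomial.monic_X_add_C _
  have hcard : Fintype.card (Fin s → ZMod p) = p ^ s := by
    rw [Fintype.card_fun, ZMod.card, Fintype.card_fin]
  have hGdeg : G.degree = (p ^ s : ℕ) := by
    rw [hG, Polynomial.degree_prod]
    simp [hcard]
  set F : Polynomial A := ∑ i : Fin (s + 1), Polynomial.C (co i) * Polynomial.X ^ p ^ (i : ℕ)
    with hF
  have hFG : F = Polynomial.C (co (Fin.last s)) * G := by
    refine Polynomial.eq_of_degree_sub_lt_of_eval_finset_eq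
      (Finset.univ.image fun c => -l c) ?_ ?_
    · rw [Finset.card_image_of_injective _ (fun a b h => hy (neg_injective h)),
        Finset.card_univ, hcard, hF,
        Fin.sum_univ_castSucc, add_sub_assoc, ← mul_sub]
      refine lt_of_le_of_lt (Polynomial.degree_add_le _ _) (max_lt ?_ ?_)
      · refine (Polynomial.degree_sum_le _ _).trans_lt ?_
        rw [Finset.sup_lt_iff (WithBot.bot_lt_coe _)]
        intro i _
        refine (Polynomial.degree_C_mul_X_pow_le _ _).trans_lt ?_
        exact_mod_cast Nat.pow_lt_pow_right hp.out.one_lt (by simp)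
      · rw [← Polynomial.smul_eq_C_mul, Fin.val_last]
        refine (Polynomial.degree_smul_le _ _).trans_lt ?_
        refine (Polynomial.degree_sub_lt_left ?_ (Polynomial.monic_X_pow _).ne_zero ?_).trans_eq
          (Polynomial.degree_X_pow _)
        · rw [hGdeg, Polynomial.degree_X_pow]
        · rw [(Polynomial.monic_X_pow _).leadingCoeff, hGm.leadingCoeff]
    · intro z hz
      obtain ⟨c, -, rfl⟩ := Finset.mem_image.1 hz
      have h0 : G.eval (-l c) = 0 := by
        rw [hG, Polynomial.eval_prod]
        exact Finset.prod_eq_zero (Finset.mem_univ c) (by simp)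
      rw [Polynomial.eval_mul, h0, mul_zero, hF, Polynomial.eval_finsetSum]
      simpa using hroot c
  have h := congrArg (Polynomial.eval (y (Fin.last s))) hFG
  have hsnoc : (Fin.snoc (fun i : Fin s => y i.castSucc) (y (Fin.last s)) : Fin (s + 1) → A) = y :=
    Fin.snoc_init_self y
  rw [hF, Polynomial.eval_finsetSum, Polynomial.eval_mul, hG, Polynomial.eval_prod, hco_last] at h
  simp only [Polynomial.eval_mul, Polynomial.eval_C, Polynomial.eval_pow, Polynomial.eval_X,
    Polynomial.eval_add] at h
  rw [← hexp, hsnoc] at h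
  rw [h]
  exact congrArg _ (Finset.prod_congr rfl fun c _ => add_comm _ _)

/-! ### Moore determinants of consecutive variables -/

/-- The Moore determinant of the `s` consecutive variables `x_{i-s+1}, …, x_i`. -/
noncomputable def windowDet (p n i s : ℕ) : MvPolynomial (Fin n) (ZMod p) :=
  mooreDet p fun b : Fin s => polyVar p n (i - s + 1 + b)

theorem eval_indicator_polyVar {p n j : ℕ} (m : ℕ) (hj : j < n) :
    MvPolynomial.eval (fun v : Fin n => if (v : ℕ) = m then (1 : ZMod p) else 0)
      (polyVar p n (j + 1)) = if j = m then 1 else 0 := by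
  rw [polyVar, dif_pos ⟨by omega, by omega⟩, MvPolynomial.eval_X]
  simp

theorem windowDet_succ {p n a s : ℕ} [hp : Fact p.Prime] (hn : a + s < n) :
    windowDet p n (a + s + 1) (s + 1) = windowDet p n (a + s) s *
      ∏ c : Fin s → ZMod p, (∑ j : Fin s, MvPolynomial.C (c j) * polyVar p n (a + 1 + j) +
        polyVar p n (a + s + 1)) := by
  have h1 : a + s + 1 - (s + 1) = a := by omega
  have h2 : a + s - s = a := by omega
  have h3 : a + 1 + s = a + s + 1 := by omega
  rw [windowDet, windowDet, h1, h2, mooreDet_succ]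
  · simp only [Fin.val_castSucc, Fin.val_last, h3, MvPolynomial.algebraMap_eq]
    rfl
  · intro c c' h
    funext j
    have h := congrArg
      (MvPolynomial.eval fun v : Fin n => if (v : ℕ) = a + j then (1 : ZMod p) else 0) h
    have he : ∀ b : Fin s, MvPolynomial.eval
        (fun v : Fin n => if (v : ℕ) = a + j then (1 : ZMod p) else 0)
        (polyVar p n (a + 1 + b)) = if b = j then 1 else 0 := by
      intro b
      rw [add_right_comm, eval_indicator_polyVar _ (by omega)]
      simp [Fin.ext_iff]
    simpa [MvPolynomial.algebraMap_eq, he] using h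

theorem windowDet_ne_zero {p n a s : ℕ} [hp : Fact p.Prime] (hn : a + s ≤ n) :
    windowDet p n (a + s) s ≠ 0 := by
  induction s with
  | zero => simp [windowDet, mooreDet]
  | succ s ih =>
    rw [← add_assoc, windowDet_succ (by omega)]
    refine mul_ne_zero (ih (by omega)) (Finset.prod_ne_zero_iff.2 fun c _ h => ?_)
    have h := congrArg
      (MvPolynomial.eval fun v : Fin n => if (v : ℕ) = a + s then (1 : ZMod p) else 0) h
    have he : ∀ b : Fin s, MvPolynomial.eval
        (fun v : Fin n => if (v : ℕ) = a + s then (1 : ZMod p) else 0)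
        (polyVar p n (a + 1 + b)) = 0 := by
      intro b
      rw [add_right_comm, eval_indicator_polyVar _ (by omega), if_neg (by omega)]
    simp [he, eval_indicator_polyVar _ (show a + s < n by omega)] at h

theorem coeff_zero_totalConjugatePower (p : ℕ) [Fact p.Prime] (σ : Type*)
    (f : MvPolynomial σ (ZMod p)) : PowerSeries.coeff 0 (totalConjugatePower p σ f) = f := by
  rw [← hatSteenrodPower_apply, hatSteenrodPower, pow_zero, one_mul, chiSteenrodPower,
    Module.End.one_apply]

theorem totalConjugatePower_polyVar (p n i : ℕ) :
    totalConjugatePower p (Fin n) (polyVar p n i) = conjugateSeries p (polyVar p n i) := by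
  rw [polyVar]
  split_ifs
  · rw [totalConjugatePower, MvPolynomial.aeval_X]
  · rw [map_zero]
    ext N
    simp [conjugateSeries]

/-- `X_pow_mul_mooreDet_conjugateSeries` for a window of variables, with the combination extended by
zero to all the variables up to the last one of the window. -/
theorem X_pow_mul_totalConjugatePower_windowDet {p n a s : ℕ} [hp : Fact p.Prime] :
    ∃ c : ℕ → MvPolynomial (Fin n) (ZMod p), c (a + s) = windowDet p n (a + s) s ∧
      PowerSeries.X ^ pNumber p s *
          totalConjugatePower p (Fin n) (windowDet p n (a + s + 1) (s + 1)) =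
        ∑ j ∈ Finset.range (a + s + 1),
          PowerSeries.C (c j) * conjugateSeries p (polyVar p n (j + 1)) := by
  have h1 : a + s + 1 - (s + 1) = a := by omega
  have h2 : a + s - s = a := by omega
  set y : Fin (s + 1) → MvPolynomial (Fin n) (ZMod p) := fun b => polyVar p n (a + 1 + b) with hy
  have hmap : totalConjugatePower p (Fin n) (windowDet p n (a + s + 1) (s + 1)) =
      mooreDet p fun j => conjugateSeries p (y j) := by
    rw [windowDet, h1, mooreDet, mooreDet, AlgHom.map_det]
    congr 1
    ext1 i j
    simp [totalConjugatePower_polyVar, hy]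
  refine ⟨fun j => if h : a ≤ j ∧ j < a + (s + 1) then mooreCofactor p y ⟨j - a, by omega⟩ else 0,
    ?_, ?_⟩
  · have h : (⟨a + s - a, by omega⟩ : Fin (s + 1)) = Fin.last s := by
      ext; simp
    have hw : windowDet p n (a + s) s = mooreDet p (y ∘ Fin.castSucc) := by
      rw [windowDet, h2]; rfl
    rw [hw, ← mooreCofactor_last, ← h]
    exact dif_pos ⟨Nat.le_add_right a s, by omega⟩
  · dsimp only
    rw [hmap, X_pow_mul_mooreDet_conjugateSeries, add_assoc, Finset.sum_range_add,
      Finset.sum_eq_zero (s := Finset.range a), zero_add, Finset.sum_range]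
    · refine Finset.sum_congr rfl fun j _ => ?_
      rw [dif_pos ⟨by omega, by omega⟩]
      have h : (⟨a + j - a, by omega⟩ : Fin (s + 1)) = j := by ext; simp
      rw [h, add_right_comm a (j : ℕ) 1]
    · intro j hj
      rw [Finset.mem_range] at hj
      rw [dif_neg (by omega), map_zero, zero_mul]

/-! ### The linking identity for windows of variables -/

theorem sub_one_mul_pNumber (p k : ℕ) [hp : Fact p.Prime] :
    (p - 1) * pNumber p k + 1 = p ^ k := by
  induction k with
  | zero => simp [pNumber]
  | succ k ih =>
    have := hp.out.pos
    obtain ⟨q, rfl⟩ : ∃ q, p = q + 1 := ⟨p - 1, by omega⟩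
    rw [pNumber_succ, pow_succ]
    rw [Nat.add_sub_cancel] at *
    linear_combination ih

theorem sum_pow_div (p q m b : ℕ) (hq : 0 < q) (hb : b ≤ q) :
    ∑ k ∈ Finset.range (m * q + b), p ^ (k / q) = (∑ i ∈ Finset.range m, q * p ^ i) + b * p ^ m := by
  have hblock : ∀ m b, b ≤ q → ∑ k ∈ Finset.range b, p ^ ((m * q + k) / q) = b * p ^ m := by
    intro m b hb
    rw [Finset.sum_congr rfl (g := fun _ => p ^ m), Finset.sum_const, Finset.card_range, smul_eq_mul]
    intro k hk
    rw [Finset.mem_range] at hk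
    rw [mul_comm, Nat.mul_add_div hq, Nat.div_eq_of_lt (by omega), add_zero]
  rw [Finset.sum_range_add, hblock m b hb]
  congr 1
  induction m with
  | zero => simp
  | succ m ih => rw [add_mul, one_mul, Finset.sum_range_add, ih, hblock m q le_rfl,
      Finset.sum_range_succ]

theorem sum_pow_div_add_one (p m b : ℕ) [hp : Fact p.Prime] (hb : b ≤ p - 1) :
    ∑ k ∈ Finset.range (m * (p - 1) + b), p ^ (k / (p - 1)) + 1 = (b + 1) * p ^ m := by
  have h1 := hp.out.one_lt
  rw [sum_pow_div p (p - 1) m b (by omega) hb, ← Finset.mul_sum]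
  have h := sub_one_mul_pNumber p m
  rw [pNumber_eq_sum] at h
  linear_combination h

/-- The exponent `R = ∑ pNumber (k / (p - 1))` is the one to which
`coeff_prod_sum_conjugateSeries` applies: `(p - 1) R + γ = (b + 1) p ^ m - 1` has digit sum
`γ = m (p - 1) + b`. -/
theorem sub_one_mul_sum_pNumber_add (p m b : ℕ) [hp : Fact p.Prime] (hb : b ≤ p - 1) :
    (p - 1) * (∑ k ∈ Finset.range (m * (p - 1) + b), pNumber p (k / (p - 1))) +
      (m * (p - 1) + b) + 1 = (b + 1) * p ^ m := by
  rw [← sum_pow_div_add_one p m b hb, Finset.mul_sum]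
  simp_rw [← sub_one_mul_pNumber, Finset.sum_add_distrib]
  simp

/-- The coefficient is extracted by `coeff_prod_sum_conjugateSeries`. As the right-hand side depends
on `s` only through the coefficients of the top terms, the remaining factor is found from the case
`s k = k / (p - 1)`, in which the coefficient is the lowest one. -/
theorem hatSteenrodPower_prod_windowDet {p n m b : ℕ} [hp : Fact p.Prime] (hb : b ≤ p - 1)
    (s : ℕ → ℕ) (hs : ∀ k < m * (p - 1) + b, s k ≤ k / (p - 1)) (r : ℕ)
    (hr : r + ∑ k ∈ Finset.range (m * (p - 1) + b), pNumber p (s k) =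
      ∑ k ∈ Finset.range (m * (p - 1) + b), pNumber p (k / (p - 1))) :
    hatSteenrodPower p (Fin n) r
        (∏ k ∈ Finset.range (m * (p - 1) + b), windowDet p n (k / (p - 1) + 1) (s k + 1)) *
      ∏ k ∈ Finset.range (m * (p - 1) + b), windowDet p n (k / (p - 1)) (k / (p - 1)) =
    (∏ k ∈ Finset.range (m * (p - 1) + b), windowDet p n (k / (p - 1)) (s k)) *
      ∏ k ∈ Finset.range (m * (p - 1) + b), windowDet p n (k / (p - 1) + 1) (k / (p - 1) + 1) := by
  set γ := m * (p - 1) + b with hγ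
  set R := ∑ k ∈ Finset.range γ, pNumber p (k / (p - 1)) with hR
  have hdig : (p.digits ((p - 1) * R + γ)).sum = γ := by
    have h := sub_one_mul_sum_pNumber_add p m b hb
    rw [← hγ, ← hR] at h
    have h' : (p - 1) * R + γ = (b + 1) * p ^ m - 1 := by omega
    have := hp.out.one_lt
    rw [h', sum_digits_mul_pow_sub_one p b m (by omega)]
  set T := PowerSeries.coeff R (∏ k : Fin γ,
    conjugateSeries p (polyVar p n ((k : ℕ) / (p - 1) + 1))) with hT
  have key : ∀ (s : ℕ → ℕ) (r : ℕ), (∀ k < γ, s k ≤ k / (p - 1)) →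
      r + ∑ k ∈ Finset.range γ, pNumber p (s k) = R →
      hatSteenrodPower p (Fin n) r
        (∏ k ∈ Finset.range γ, windowDet p n (k / (p - 1) + 1) (s k + 1)) =
      (∏ k ∈ Finset.range γ, windowDet p n (k / (p - 1)) (s k)) * T := by
    intro s r hs hr
    have hex : ∀ k : Fin γ, ∃ c : ℕ → MvPolynomial (Fin n) (ZMod p),
        c ((k : ℕ) / (p - 1)) = windowDet p n ((k : ℕ) / (p - 1)) (s k) ∧
        PowerSeries.X ^ pNumber p (s k) *
          totalConjugatePower p (Fin n) (windowDet p n ((k : ℕ) / (p - 1) + 1) (s k + 1)) =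
        ∑ j ∈ Finset.range ((k : ℕ) / (p - 1) + 1),
          PowerSeries.C (c j) * conjugateSeries p (polyVar p n (j + 1)) := by
      intro k
      have h := X_pow_mul_totalConjugatePower_windowDet (p := p) (n := n)
        (a := (k : ℕ) / (p - 1) - s k) (s := s k)
      rwa [Nat.sub_add_cancel (hs k k.2)] at h
    choose c hc1 hc2 using hex
    have h := coeff_prod_sum_conjugateSeries (fun j => polyVar p n (j + 1)) c hdig
    simp only [← hc2, hc1] at h
    rw [Finset.prod_mul_distrib, Finset.prod_pow_eq_pow_sum, ← map_prod,
      ← Finset.prod_range (fun k => windowDet p n (k / (p - 1) + 1) (s k + 1)),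
      ← Finset.prod_range (fun k => windowDet p n (k / (p - 1)) (s k)),
      ← Finset.sum_range (fun k => pNumber p (s k)), ← hr, PowerSeries.coeff_X_pow_mul,
      ← hatSteenrodPower_apply, hr] at h
    exact h
  have h1 := key s r hs hr
  have h2 := key (fun k => k / (p - 1)) 0 (fun _ _ => le_rfl) (zero_add _)
  rw [hatSteenrodPower_apply, coeff_zero_totalConjugatePower] at h2
  rw [h1, h2]
  ring

/-- Both sides are products of linear forms by `windowDet_succ`: the forms in the variables up to
`x_{i+1}`, with `i = a + s`, split into those missing the first `a` variables, which make up the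
quotient of window determinants, and those given by `factorVectors`. -/
theorem windowDet_mul_windowDet {p n a s : ℕ} [hp : Fact p.Prime] (hn : a + s < n) :
    windowDet p n (a + s) s * windowDet p n (a + s + 1) (a + s + 1) =
      windowDet p n (a + s + 1) (s + 1) *
        (∏ᶠ c ∈ factorVectors p (a + s + 1) (s + 1), monicLinearForm p n (a + s + 1) c) *
        windowDet p n (a + s) (a + s) := by
  classical
  have hfull := windowDet_succ (p := p) (n := n) (a := 0) (s := a + s) (by omega)
  simp only [zero_add] at hfull
  obtain ⟨F, hF⟩ : ∃ F : Set (Fin (a + s) → ZMod p), F = factorVectors p (a + s + 1) (s + 1) :=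
    ⟨_, rfl⟩
  obtain ⟨L, hL⟩ : ∃ L : (Fin (a + s) → ZMod p) → MvPolynomial (Fin n) (ZMod p),
    L = monicLinearForm p n (a + s + 1) := ⟨_, rfl⟩
  have hlin : ∀ c : Fin (a + s) → ZMod p,
      ∑ j : Fin (a + s), MvPolynomial.C (c j) * polyVar p n (1 + j) + polyVar p n (a + s + 1) =
        L c := by
    intro c
    rw [hL]
    simp only [monicLinearForm, add_comm 1]
    rfl
  have hfin : ∏ᶠ c ∈ factorVectors p (a + s + 1) (s + 1), monicLinearForm p n (a + s + 1) c =
      ∏ c with c ∈ F, L c := by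
    rw [← hF, ← hL, ← finprod_mem_coe_finset]
    simp
  have hmem : ∀ c : Fin (a + s) → ZMod p, c ∉ F ↔ ∀ j : Fin a, c (Fin.castAdd s j) = 0 := by
    intro c
    rw [hF]
    constructor
    · intro h j
      by_contra hc
      exact h ⟨Fin.castAdd s j, by rw [Fin.val_castAdd]; omega, hc⟩
    · rintro h ⟨j, hj, hc⟩
      exact hc (h ⟨j, by omega⟩)
  -- the vectors left out are those supported on the last `s` coordinates
  have hcompl : ∏ c with c ∉ F, L c =
      ∏ c : Fin s → ZMod p, (∑ j : Fin s, MvPolynomial.C (c j) * polyVar p n (a + 1 + j) +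
        polyVar p n (a + s + 1)) := by
    symm
    refine Finset.prod_nbij' (fun d => Fin.append 0 d) (fun c j => c (Fin.natAdd a j)) ?_ ?_ ?_ ?_ ?_
    · intro d _
      rw [Finset.mem_filter]
      exact ⟨Finset.mem_univ _, (hmem _).2 fun j => by simp⟩
    · intro c _
      exact Finset.mem_univ _
    · intro d _
      funext j
      simp
    · intro c hc
      have hc := (hmem c).1 (Finset.mem_filter.1 hc).2
      funext j
      induction j using Fin.addCases with
      | left j => simp [hc j]
      | right j => simp
    · intro d _
      rw [← hlin, Fin.sum_univ_add]
      simp [add_left_comm, add_assoc]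
  have hsplit := Finset.prod_filter_mul_prod_filter_not Finset.univ (fun c => c ∈ F) L
  simp only [hlin] at hfull
  rw [hfull, windowDet_succ hn, hfin, ← hcompl, ← hsplit]
  ring

/-! ### Antidiagonals of a column regular diagram -/

/-- Counting rows, columns and antidiagonals from `0`, the antidiagonal `k` starts in the box
`(k / (p - 1), k % (p - 1))`, whether or not this box is in the diagram, and its boxes are reached by
going up one row and right `p - 1` columns at a time. -/
theorem mem_antidiagonalBoxes_iff {p : ℕ} (hp : 1 < p) (lam : YoungDiagram) (k i j : ℕ) :
    (i, j) ∈ antidiagonalBoxes p lam (k + 1) ↔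
      ∃ t, i + t = k / (p - 1) ∧ j = k % (p - 1) + t * (p - 1) ∧ j < lam.rowLen i := by
  obtain ⟨q, rfl⟩ : ∃ q, p = q + 1 := ⟨p - 1, by omega⟩
  have hq : 0 < q := by omega
  rw [antidiagonalBoxes, Finset.mem_filter, YoungDiagram.mem_cells, YoungDiagram.mem_iff_lt_rowLen]
  simp only [Nat.add_sub_cancel]
  have hk := Nat.div_add_mod k q
  have hm := Nat.mod_lt k hq
  constructor
  · rintro ⟨h1, h2⟩
    have h3 : j + i * q = k := by rw [add_mul] at h2; omega
    refine ⟨j / q, ?_, ?_, h1⟩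
    · rw [← h3, Nat.add_mul_div_right _ _ hq, add_comm]
    · rw [← h3, Nat.add_mul_mod_self_right, mul_comm, Nat.mod_add_div]
  · rintro ⟨t, h1, h2, h3⟩
    refine ⟨h3, ?_⟩
    rw [← h1] at hk
    rw [h2]
    linear_combination hk

/-- Column regularity means that going down an antidiagonal one does not leave the diagram. -/
theorem IsColumnRegular.lt_rowLen {p : ℕ} {lam : YoungDiagram} (hreg : IsColumnRegular p lam)
    {i c t u : ℕ} (hut : u ≤ t) (hti : t ≤ i) (h : c + t * (p - 1) < lam.rowLen (i - t)) :
    c + u * (p - 1) < lam.rowLen (i - u) := by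
  induction t, hut using Nat.le_induction with
  | base => exact h
  | succ t _ ih =>
    refine ih (by omega) ?_
    have h1 := hreg (i - (t + 1))
    have h2 : i - (t + 1) + 1 = i - t := by omega
    rw [h2] at h1
    rw [add_mul] at h
    omega

theorem lt_antidiagonalLength_iff {p : ℕ} (hp : 1 < p) {lam : YoungDiagram}
    (hreg : IsColumnRegular p lam) (k t : ℕ) :
    t < antidiagonalLength p lam (k + 1) ↔
      t ≤ k / (p - 1) ∧ k % (p - 1) + t * (p - 1) < lam.rowLen (k / (p - 1) - t) := by
  set I := (Finset.range (k / (p - 1) + 1)).filter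
    (fun t => k % (p - 1) + t * (p - 1) < lam.rowLen (k / (p - 1) - t)) with hI
  have hmem : ∀ t, t ∈ I ↔
      t ≤ k / (p - 1) ∧ k % (p - 1) + t * (p - 1) < lam.rowLen (k / (p - 1) - t) := by
    intro t
    rw [hI, Finset.mem_filter, Finset.mem_range, Nat.lt_succ_iff]
  have hcard : antidiagonalLength p lam (k + 1) = I.card := by
    symm
    refine Finset.card_nbij' (fun t => (k / (p - 1) - t, k % (p - 1) + t * (p - 1)))
      (fun b => k / (p - 1) - b.1) ?_ ?_ ?_ ?_
    · intro t ht
      obtain ⟨h1, h2⟩ := (hmem t).1 ht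
      exact (mem_antidiagonalBoxes_iff hp lam k _ _).2 ⟨t, by omega, rfl, h2⟩
    · rintro ⟨i, j⟩ hb
      obtain ⟨t, h1, h2, h3⟩ := (mem_antidiagonalBoxes_iff hp lam k i j).1 hb
      have h4 : k / (p - 1) - i = t := by omega
      have h5 : k / (p - 1) - t = i := by omega
      refine (hmem _).2 ⟨Nat.sub_le _ _, ?_⟩
      dsimp only
      rw [h4, h5, ← h2]
      exact h3
    · intro t ht
      have := ((hmem t).1 ht).1
      dsimp only
      omega
    · rintro ⟨i, j⟩ hb
      obtain ⟨t, h1, h2, h3⟩ := (mem_antidiagonalBoxes_iff hp lam k i j).1 hb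
      have h4 : k / (p - 1) - i = t := by omega
      have h5 : k / (p - 1) - t = i := by omega
      simp only [h4, h5, h2]
  -- `I` is closed downwards, hence an initial segment
  have hlow : ∀ t ∈ I, ∀ u ≤ t, u ∈ I := by
    intro t ht u hu
    obtain ⟨h1, h2⟩ := (hmem t).1 ht
    exact (hmem u).2 ⟨hu.trans h1, hreg.lt_rowLen hu h1 h2⟩
  rw [hcard, ← hmem]
  constructor
  · intro h
    by_contra ht
    have hsub : I ⊆ Finset.range t := by
      intro u hu
      rw [Finset.mem_range]
      by_contra hut
      exact ht (hlow u hu t (by omega))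
    have := Finset.card_le_card hsub
    rw [Finset.card_range] at this
    omega
  · intro ht
    have hsub : Finset.range (t + 1) ⊆ I := by
      intro u hu
      exact hlow t ht u (Nat.lt_succ_iff.1 (Finset.mem_range.1 hu))
    have := Finset.card_le_card hsub
    rw [Finset.card_range] at this
    omega

theorem antidiagonalLowRow_eq {p : ℕ} (hp : 1 < p) {lam : YoungDiagram}
    (hreg : IsColumnRegular p lam) {k : ℕ} (hk : 0 < antidiagonalLength p lam (k + 1)) :
    antidiagonalLowRow p lam (k + 1) = k / (p - 1) + 1 := by
  refine le_antisymm (Finset.sup_le ?_) ?_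
  · rintro ⟨i, j⟩ hb
    obtain ⟨t, h1, -, -⟩ := (mem_antidiagonalBoxes_iff hp lam k i j).1 hb
    dsimp only
    omega
  · have h := ((lt_antidiagonalLength_iff hp hreg k 0).1 hk).2
    rw [Nat.sub_zero] at h
    have hmem := (mem_antidiagonalBoxes_iff hp lam k (k / (p - 1)) (k % (p - 1) + 0 * (p - 1))).2
      ⟨0, rfl, rfl, h⟩
    exact Finset.le_sup (f := fun c : ℕ × ℕ => c.1 + 1) hmem

/-- The boxes in the block `t` of `p - 1` columns, counting from `0`, are in bijection with the
antidiagonals with more than `t` boxes. -/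
theorem tConjugate_eq_card {p : ℕ} (hp : 1 < p) {lam : YoungDiagram}
    (hreg : IsColumnRegular p lam) {γ : ℕ}
    (hγ : ∀ k, 0 < antidiagonalLength p lam (k + 1) ↔ k < γ) (t : ℕ) :
    tConjugate p lam (t + 1) =
      ((Finset.range γ).filter fun k => t < antidiagonalLength p lam (k + 1)).card := by
  have hq : 0 < p - 1 := by omega
  have hbox : ∀ i j, t * (p - 1) ≤ j → j < t * (p - 1) + (p - 1) →
      (i * (p - 1) + j) / (p - 1) = i + t ∧ (i * (p - 1) + j) % (p - 1) = j - t * (p - 1) := by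
    intro i j h2 h3
    have h4 : i * (p - 1) + j = (p - 1) * (i + t) + (j - t * (p - 1)) := by
      rw [mul_add, mul_comm i, mul_comm t]
      rw [mul_comm t] at h2
      omega
    constructor
    · rw [h4, Nat.mul_add_div hq, Nat.div_eq_of_lt (by omega), add_zero]
    · rw [h4, Nat.mul_add_mod, Nat.mod_eq_of_lt (by omega)]
  symm
  refine Finset.card_nbij' (fun k => (k / (p - 1) - t, k % (p - 1) + t * (p - 1)))
    (fun b => b.1 * (p - 1) + b.2) ?_ ?_ ?_ ?_
  · intro k hk
    have hk := (Finset.mem_filter.1 hk).2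
    obtain ⟨h1, h2⟩ := (lt_antidiagonalLength_iff hp hreg k t).1 hk
    have hm := Nat.mod_lt k hq
    refine Finset.mem_filter.2 ⟨YoungDiagram.mem_iff_lt_rowLen.2 h2, ?_, ?_⟩
    · simp
    · dsimp only
      rw [add_mul]
      omega
  · rintro ⟨i, j⟩ hb
    obtain ⟨h1, h2, h3⟩ := Finset.mem_filter.1 hb
    rw [YoungDiagram.mem_cells, YoungDiagram.mem_iff_lt_rowLen] at h1
    simp only [Nat.add_sub_cancel, add_mul, one_mul] at h2 h3
    obtain ⟨h5, h6⟩ := hbox i j h2 h3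
    have h7 : t < antidiagonalLength p lam (i * (p - 1) + j + 1) := by
      rw [lt_antidiagonalLength_iff hp hreg, h5, h6, Nat.add_sub_cancel, Nat.sub_add_cancel h2]
      exact ⟨Nat.le_add_left t i, h1⟩
    exact Finset.mem_filter.2 ⟨Finset.mem_range.2 ((hγ _).1 (Nat.zero_lt_of_lt h7)), h7⟩
  · intro k hk
    have hk := (Finset.mem_filter.1 hk).2
    obtain ⟨h1, h2⟩ := (lt_antidiagonalLength_iff hp hreg k t).1 hk
    have h3 := Nat.div_add_mod k (p - 1)
    have h4 : (k / (p - 1) - t) * (p - 1) + t * (p - 1) = (p - 1) * (k / (p - 1)) := by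
      rw [← add_mul, Nat.sub_add_cancel h1, mul_comm]
    dsimp only
    omega
  · rintro ⟨i, j⟩ hb
    obtain ⟨h1, h2, h3⟩ := Finset.mem_filter.1 hb
    simp only [Nat.add_sub_cancel, add_mul, one_mul] at h2 h3
    obtain ⟨h5, h6⟩ := hbox i j h2 h3
    simp only [h5, h6, Nat.add_sub_cancel, Nat.sub_add_cancel h2]

theorem tConjugate_one {p : ℕ} (hp : 1 < p) {lam : YoungDiagram}
    (hreg : IsColumnRegular p lam) {γ : ℕ}
    (hγ : ∀ k, 0 < antidiagonalLength p lam (k + 1) ↔ k < γ) : tConjugate p lam 1 = γ := by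
  rw [tConjugate_eq_card hp hreg hγ 0, Finset.filter_true_of_mem, Finset.card_range]
  exact fun k hk => (hγ k).2 (Finset.mem_range.1 hk)

/-- Double counting: an antidiagonal of length `l` contributes `1 + p + ⋯ + p ^ (l - 2)`, one power
for each of its boxes outside the first block of columns. -/
theorem sum_pow_mul_tConjugate {p : ℕ} [hp : Fact p.Prime] {lam : YoungDiagram}
    (hreg : IsColumnRegular p lam) {γ : ℕ}
    (hγ : ∀ k, 0 < antidiagonalLength p lam (k + 1) ↔ k < γ) :
    ∑ j ∈ Finset.Icc 2 (tLength p lam), p ^ (j - 2) * tConjugate p lam j =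
      ∑ k ∈ Finset.range γ, pNumber p (antidiagonalLength p lam (k + 1) - 1) := by
  have h1 := hp.out.one_lt
  have hq : 0 < p - 1 := by omega
  have hbound : ∀ k, antidiagonalLength p lam (k + 1) ≤ tLength p lam := by
    intro k
    by_contra! h
    have h2 := ((lt_antidiagonalLength_iff h1 hreg k _).1 h).2
    have h3 := lam.rowLen_anti 0 (k / (p - 1) - tLength p lam) (Nat.zero_le _)
    have h4 : lam.rowLen 0 ≤ (p - 1) • tLength p lam := le_smul_ceilDiv hq
    rw [smul_eq_mul, mul_comm] at h4
    omega
  have hp : ∀ k ∈ Finset.range γ, pNumber p (antidiagonalLength p lam (k + 1) - 1) =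
      ∑ j ∈ Finset.Icc 2 (tLength p lam),
        if j - 1 < antidiagonalLength p lam (k + 1) then p ^ (j - 2) else 0 := by
    intro k hk
    have hb := hbound k
    rw [pNumber_eq_sum, ← Finset.sum_filter]
    refine Finset.sum_nbij' (fun i => i + 2) (fun j => j - 2) ?_ ?_ ?_ ?_ ?_
    · intro i hi
      rw [Finset.mem_range] at hi
      rw [Finset.mem_filter, Finset.mem_Icc]
      omega
    · intro j hj
      rw [Finset.mem_filter, Finset.mem_Icc] at hj
      rw [Finset.mem_range]
      omega
    · intro i _
      simp
    · intro j hj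
      rw [Finset.mem_filter, Finset.mem_Icc] at hj
      omega
    · intro i _
      simp
  rw [Finset.sum_congr rfl hp, Finset.sum_comm]
  refine Finset.sum_congr rfl fun j hj => ?_
  rw [Finset.mem_Icc] at hj
  obtain ⟨t, rfl⟩ : ∃ t, j = t + 1 := ⟨j - 1, by omega⟩
  rw [tConjugate_eq_card h1 hreg hγ, ← Finset.sum_filter, Finset.sum_const, smul_eq_mul, mul_comm]
  rfl

/-- In a `T`-regular diagram only the last row can be shorter than `p - 1`. Hence there are
`(n - 1)(p - 1) + λ_n` nonempty antidiagonals, one for each box in the first `p - 1` columns. -/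
theorem antidiagonalLength_pos_iff {p m : ℕ} (hp : 1 < p) {lam : YoungDiagram}
    (hlen : lam.colLen 0 = m + 1) (hreg : IsTRegular p lam) (k : ℕ) :
    0 < antidiagonalLength p lam (k + 1) ↔ k < m * (p - 1) + lam.rowLen m := by
  have hq : 0 < p - 1 := by omega
  have hrow : ∀ i, 0 < lam.rowLen i ↔ i < m + 1 := by
    intro i
    rw [← hlen, ← YoungDiagram.mem_iff_lt_rowLen, YoungDiagram.mem_iff_lt_colLen]
  have hlong : ∀ i < m, p - 1 ≤ lam.rowLen i := by
    intro i hi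
    by_contra! h
    have h1 := lam.rowLen_anti i m hi.le
    have := hreg.2 1 le_rfl i m
    simp only [Nat.sub_self, zero_mul, one_mul] at this
    have := this ((hrow i).2 (by omega)) h ((hrow m).2 (by omega)) (by omega)
    omega
  have hm := hreg.1 m
  have hz : ∀ i, m < i → lam.rowLen i = 0 := by
    intro i hi
    have := (hrow i).not.2 (by omega)
    omega
  rw [hz (m + 1) (by omega)] at hm
  rw [lt_antidiagonalLength_iff hp hreg.1]
  simp only [Nat.zero_le, true_and, zero_mul, add_zero, Nat.sub_zero]
  have h3 := Nat.div_add_mod k (p - 1)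
  have h4 := Nat.mod_lt k hq
  rcases lt_trichotomy (k / (p - 1)) m with h | h | h
  · have h5 := Nat.mul_le_mul_left (p - 1) (Nat.succ_le_of_lt h)
    rw [Nat.mul_succ, mul_comm _ m] at h5
    have := hlong _ h
    omega
  · rw [h]
    rw [h, mul_comm] at h3
    omega
  · have h5 := Nat.mul_le_mul_left (p - 1) (Nat.succ_le_of_lt h)
    rw [Nat.mul_succ, mul_comm _ m] at h5
    rw [hz _ h]
    omega

/-! ### The linking theorem -/

theorem prod_Icc_one_eq_prod_range {M : Type*} [CommMonoid M] (f : ℕ → M) (γ : ℕ) :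
    ∏ k ∈ Finset.Icc 1 γ, f k = ∏ k ∈ Finset.range γ, f (k + 1) := by
  rw [Finset.range_eq_Ico, Finset.prod_Ico_add' f 0 γ 1]
  rfl

/-- The first exponent is the difference between the exponent `R` in which the coefficient is
extracted and the shifts `pNumber (s_k - 1)` of the Moore determinants. -/
theorem firstExponent_eq {p m : ℕ} [hp : Fact p.Prime] {lam : YoungDiagram}
    (hreg : IsColumnRegular p lam) {b : ℕ} (hb : 1 ≤ b) (hbq : b ≤ p - 1)
    (hγ : ∀ k, 0 < antidiagonalLength p lam (k + 1) ↔ k < m * (p - 1) + b) :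
    firstExponent p lam =
      (∑ k ∈ Finset.range (m * (p - 1) + b), pNumber p (k / (p - 1)) : ℕ) -
        (∑ k ∈ Finset.range (m * (p - 1) + b),
          pNumber p (antidiagonalLength p lam (k + 1) - 1) : ℕ) := by
  have h1 := hp.out.one_lt
  have hq : 0 < p - 1 := by omega
  have hcard : tConjugate p lam 1 = m * (p - 1) + b := tConjugate_one h1 hreg hγ
  have hpred : m * (p - 1) + b - 1 = (p - 1) * m + (b - 1) := by rw [mul_comm]; omega
  have hdiv : (tConjugate p lam 1 - 1) / (p - 1) = m := by
    rw [hcard, hpred, Nat.mul_add_div hq, Nat.div_eq_of_lt (by omega), add_zero]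
  have hmod : (tConjugate p lam 1 - 1) % (p - 1) + 1 = b := by
    rw [hcard, hpred, Nat.mul_add_mod, Nat.mod_eq_of_lt (by omega)]
    omega
  rw [firstExponent, hdiv, hmod, ← sum_pow_mul_tConjugate hreg hγ]
  push_cast
  have h2 := sub_one_mul_sum_pNumber_add p m b hbq
  have h3 := sub_one_mul_pNumber p m
  obtain ⟨q, rfl⟩ : ∃ q, p = q + 1 := ⟨p - 1, by omega⟩
  rw [← h3] at h2
  simp only [Nat.add_sub_cancel] at h2 hq ⊢
  have hq' : (q : ℤ) ≠ 0 := by exact_mod_cast hq.ne'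
  congr 1
  refine mul_left_cancel₀ hq' ?_
  zify at h2
  linear_combination -h2

theorem mainTheorem9 (p n : ℕ) [Fact p.Prime] (hp : p ≠ 2) (hn : 0 < n)
    (lam : YoungDiagram) (hlen : lam.colLen 0 = n) (hreg : IsTRegular p lam) :
    vPoly p n lam ≠ 0 ∧
      ∃ r₁ : ℕ, (r₁ : ℤ) = firstExponent p lam ∧
        hatSteenrodPower p (Fin n) r₁ (vPoly p n lam) =
          vPoly p n lam *
            ∏ k ∈ Finset.Icc 1 (tConjugate p lam 1),
              ∏ᶠ c ∈ factorVectors p (antidiagonalLowRow p lam k) (antidiagonalLength p lam k),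
                monicLinearForm p n (antidiagonalLowRow p lam k) c := by
  have h1 : 1 < p := (Fact.out : p.Prime).one_lt
  have hq : 0 < p - 1 := by omega
  obtain ⟨m, rfl⟩ : ∃ m, n = m + 1 := ⟨n - 1, by omega⟩
  set b := lam.rowLen m with hb_def
  have hb : 1 ≤ b := by
    rw [hb_def, Nat.succ_le_iff, ← YoungDiagram.mem_iff_lt_rowLen, YoungDiagram.mem_iff_lt_colLen]
    omega
  have hbq : b ≤ p - 1 := by
    have h2 : ¬ 0 < lam.rowLen (m + 1) := by
      rw [← YoungDiagram.mem_iff_lt_rowLen, YoungDiagram.mem_iff_lt_colLen]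
      omega
    have := hreg.1 m
    omega
  have hγ := antidiagonalLength_pos_iff h1 hlen hreg
  rw [← hb_def] at hγ
  set γ := m * (p - 1) + b with hγ_def
  have hcard : tConjugate p lam 1 = γ := tConjugate_one h1 hreg.1 hγ
  set s : ℕ → ℕ := fun k => antidiagonalLength p lam (k + 1) - 1 with hs_def
  have hs1 : ∀ k < γ, antidiagonalLength p lam (k + 1) = s k + 1 := fun k hk => by
    have := (hγ k).2 hk
    simp only [hs_def]
    omega
  have hs : ∀ k < γ, s k ≤ k / (p - 1) := fun k hk =>
    ((lt_antidiagonalLength_iff h1 hreg.1 k (s k)).1 (by rw [hs1 k hk]; omega)).1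
  have hrow : ∀ k < γ, antidiagonalLowRow p lam (k + 1) = k / (p - 1) + 1 := fun k hk =>
    antidiagonalLowRow_eq h1 hreg.1 ((hγ k).2 hk)
  have hdiv : ∀ k < γ, k / (p - 1) < m + 1 := fun k hk => by
    rw [Nat.div_lt_iff_lt_mul hq, add_mul]
    omega
  have hv : vPoly p (m + 1) lam =
      ∏ k ∈ Finset.range γ, windowDet p (m + 1) (k / (p - 1) + 1) (s k + 1) := by
    rw [vPoly, hcard, prod_Icc_one_eq_prod_range]
    refine Finset.prod_congr rfl fun k hk => ?_
    rw [Finset.mem_range] at hk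
    rw [← hrow k hk, ← hs1 k hk]
    rfl
  have hne : ∀ i s, s ≤ i → i ≤ m + 1 → windowDet p (m + 1) i s ≠ 0 := by
    intro i s hsi hi
    have h := windowDet_ne_zero (p := p) (n := m + 1) (a := i - s) (s := s) (by omega)
    rwa [Nat.sub_add_cancel hsi] at h
  have hle : ∑ k ∈ Finset.range γ, pNumber p (s k) ≤
      ∑ k ∈ Finset.range γ, pNumber p (k / (p - 1)) := by
    refine Finset.sum_le_sum fun k hk => ?_
    rw [pNumber_eq_sum, pNumber_eq_sum]
    exact Finset.sum_le_sum_of_subset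
      (Finset.range_mono (hs k (Finset.mem_range.1 hk)))
  refine ⟨?_, ∑ k ∈ Finset.range γ, pNumber p (k / (p - 1)) -
    ∑ k ∈ Finset.range γ, pNumber p (s k), ?_, ?_⟩
  · rw [hv]
    refine Finset.prod_ne_zero_iff.2 fun k hk => ?_
    rw [Finset.mem_range] at hk
    exact hne _ _ (Nat.succ_le_succ (hs k hk)) (hdiv k hk)
  · rw [firstExponent_eq hreg.1 hb hbq hγ, Nat.cast_sub hle]
  · have hcancel : ∏ k ∈ Finset.range γ, windowDet p (m + 1) (k / (p - 1)) (k / (p - 1)) ≠ 0 := by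
      refine Finset.prod_ne_zero_iff.2 fun k hk => hne _ _ le_rfl ?_
      exact (hdiv k (Finset.mem_range.1 hk)).le
    -- the identity holds after multiplication with the determinants of all variables before the
    -- lowest row of each antidiagonal, which are nonzero
    refine mul_right_cancel₀ hcancel ?_
    rw [hcard, hv, hatSteenrodPower_prod_windowDet hbq s hs _ (Nat.sub_add_cancel hle),
      prod_Icc_one_eq_prod_range, ← Finset.prod_mul_distrib, ← Finset.prod_mul_distrib,
      ← Finset.prod_mul_distrib]
    refine Finset.prod_congr rfl fun k hk => ?_
    rw [Finset.mem_range] at hk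
    have h := windowDet_mul_windowDet (p := p) (n := m + 1) (a := k / (p - 1) - s k) (s := s k)
      (by rw [Nat.sub_add_cancel (hs k hk)]; exact hdiv k hk)
    rw [Nat.sub_add_cancel (hs k hk)] at h
    rw [hrow k hk, hs1 k hk]
    exact h
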